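/- **Theorem (ergodic limits of $n_{ij}^+$ and $n_{ij}^-$).** Let $\mathcal G$ be an undirected weighted graph on a nonempty finite set $V$ of $n$ nodes, with symmetric entrywise nonnegative adjacency matrix $A$ in which every node has positive degree $d_i=\sum_j A_{ij}>0$. Let $\{\mathcal G_t\}_{t=1}^m$ be its connected components, where $\mathcal G_t$ has $n_t$ nodes and adjacency matrix $A_t$; let $D_t$ be the diagonal matrix with entries $D_{t,ii}=\sum_j A_{t,ij}=d_i$, and $W_t:=D_t^{-1}A_t$. *The VEC algorithm.* Let $r\ge 1$ and $w,k\ge 0$ be integers. For each node $m$ and each $p\in\{1,\dots,r\}$ let $(X^{(m,p)}_s)_{s\ge1}$ be a Markov chain with $X^{(m,p)}_1=m$ that moves inside the component of $m$ by the transition matrix $W_t$ of this component; these $rn$ walks are independent. For each walk length $\ell$ only the first $\ell$ nodes of each walk are used. The positive multiset $\mathcal D_+$ consists, with repetitions, of the pairs $(X^{(m,p)}_s,X^{(m,p)}_{s+v})$ with $m\in V$, $1\le p\le r$, $1\le v\le w$, $1\le s\le \ell-v$. For each element $(X^{(m,p)}_s,X^{(m,p)}_{s+v})$ of $\mathcal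 D_+$, the negative multiset $\mathcal D_-$ contains $k$ pairs $(X^{(m,p)}_s,Z_1),\dots,(X^{(m,p)}_s,Z_k)$, where, conditionally on the walks of length $\ell$, all the nodes $Z$ drawn are i.i.d. with distribution the empirical unigram distribution $\hat q_\ell(j)=\frac{1}{rn\ell}\,\#\{(m,p,s): s\le \ell,\ X^{(m,p)}_s=j\}$ (no assumption is made on the joint law of the negative samples for different $\ell$). Let $n^+_{ij}$ and $n^-_{ij}$ be the multiplicities of $(i,j)$ in $\mathcal D_+$ and $\mathcal D_-$. *Conclusion.* For $i\in\mathcal G_t$ put $$\pi_i=\frac{n_t}{\sum_{t'} n_{t'}}\cdot\frac{D_{t,ii}}{\sum_{i'\in\mathcal G_t}D_{t,i'i'}} .$$ Then $\pi$ is a stationary probability distribution of the random walk on $V$, and for all $i,j\in V$ the limits $$\bar n^{\pm}_{ij}:=\frac1{rn}\lim_{\ell\to\infty}\frac{n^{\pm}_{ij}}{\ell}$$ exist almost surely and are given by $$\bar n^+_{ij}=\begin{cases}\pi_i\sum_{v=1}^{w}(W_t^v)_{ij}, & \text{if } i,j\in\mathcal G_t \text{ for some } t,\\ 0,&\text{otherwise,}\end{cases}\qquad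 \bar n^-_{ij}=k\,w\,\pi_i\,\pi_j .$$ -/

import Mathlib

open Filter Topology MeasureTheory
open scoped Classical

noncomputable section

namespace VEC

variable {V : Type*} [Fintype V]

/-- The underlying simple graph of a symmetric nonnegative weighted adjacency matrix: two distinct
nodes are adjacent when the weight between them is positive. (Self-loops are allowed in `A` but
play no role for connectivity.) -/
def supportGraph (A : Matrix V V ℝ) : SimpleGraph V where
  Adj i j := i ≠ j ∧ (0 < A i j ∨ 0 < A j i)
  symm := ⟨fun _ _ h => ⟨h.1.symm, h.2.symm⟩⟩
  loopless := ⟨fun _ h => h.1 rfl⟩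

/-- The connected components `𝒢_t` of the weighted graph. -/
abbrev Component (A : Matrix V V ℝ) := (supportGraph A).ConnectedComponent

/-- The component that contains the node `i`. -/
abbrev comp (A : Matrix V V ℝ) (i : V) : Component A := (supportGraph A).connectedComponentMk i

/-- The weighted adjacency matrix `A_t` of the component `t`. -/
def compAdj (A : Matrix V V ℝ) (t : Component A) : Matrix t.supp t.supp ℝ :=
  A.submatrix Subtype.val Subtype.val

/-- The degree `d_i = ∑_j A_{t,ij}` of the node `i` of the component `t`. -/
def compDeg (A : Matrix V V ℝ) (t : Component A) (i : t.supp) : ℝ :=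
  ∑ j, compAdj A t i j

/-- The natural random walk matrix `W_t = D_t⁻¹ A_t` of the component `t`. -/
def compW (A : Matrix V V ℝ) (t : Component A) : Matrix t.supp t.supp ℝ :=
  (Matrix.diagonal (compDeg A t))⁻¹ * compAdj A t

/-- The transition matrix on all the nodes: `W_t` inside each component `t`, and no
transition between different components. -/
def transition (A : Matrix V V ℝ) : Matrix V V ℝ := fun i j =>
  if h : comp A j = comp A i then compW A (comp A i) ⟨i, rfl⟩ ⟨j, h⟩ else 0

/-- `π_i = (n_t / ∑_t n_t) * (d_i / ∑_{i' ∈ 𝒢_t} d_{i'})` for a node `i` of the component `t`. -/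
def stationary (A : Matrix V V ℝ) (i : V) : ℝ :=
  (Fintype.card (comp A i).supp : ℝ) / (∑ t : Component A, (Fintype.card t.supp : ℝ)) *
    (compDeg A (comp A i) ⟨i, rfl⟩ / ∑ i', compDeg A (comp A i) i')

/-- `p` is a stationary probability distribution of the transition matrix `P`. -/
def IsStationaryDistribution (P : Matrix V V ℝ) (p : V → ℝ) : Prop :=
  (∀ i, 0 ≤ p i) ∧ ∑ i, p i = 1 ∧ Matrix.vecMul p P = p

/-- The sample paths of `r` walks of length `ℓ` (that is, with `ℓ` nodes) from each node. The
entry at `m p s` is the node that the `p`-th walk from `m` visits at time `s`; times are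
`0, …, ℓ - 1`. -/
abbrev Paths (V : Type*) (r ℓ : ℕ) := V → Fin r → Fin ℓ → V

/-- Occurrences of `w`-skip bigrams: a walk `(m, p)` and two positions `s < s'` in it with
`s' ≤ s + w`. -/
abbrev PairIdx (V : Type*) (r w ℓ : ℕ) :=
  {a : V × Fin r × Fin ℓ × Fin ℓ //
    (a.2.2.1 : ℕ) < (a.2.2.2 : ℕ) ∧ (a.2.2.2 : ℕ) ≤ (a.2.2.1 : ℕ) + w}

/-- The node at the first position of an occurrence. -/
def firstNode {r w ℓ : ℕ} (x : Paths V r ℓ) (a : PairIdx V r w ℓ) : V :=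
  x a.1.1 a.1.2.1 a.1.2.2.1

/-- The node at the second position of an occurrence. -/
def secondNode {r w ℓ : ℕ} (x : Paths V r ℓ) (a : PairIdx V r w ℓ) : V :=
  x a.1.1 a.1.2.1 a.1.2.2.2

/-- The positive multiset `𝒟₊`. -/
def posMultiset {r ℓ : ℕ} (w : ℕ) (x : Paths V r ℓ) : Multiset (V × V) :=
  (Finset.univ : Finset (PairIdx V r w ℓ)).val.map fun a => (firstNode x a, secondNode x a)

/-- The negative multiset `𝒟₋`: for each occurrence `a` of a positive pair `(i, j)` the `k` pairs
`(i, z a c)`, where `z a c` is the `c`-th node drawn for `a`. -/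
def negMultiset {r w k ℓ : ℕ} (x : Paths V r ℓ) (z : PairIdx V r w ℓ → Fin k → V) :
    Multiset (V × V) :=
  (Finset.univ : Finset (PairIdx V r w ℓ × Fin k)).val.map
    fun b => (firstNode x b.1, z b.1 b.2)

/-- The empirical unigram distribution: the relative frequency of `j` in all the sample paths. -/
def unigram {r ℓ : ℕ} (x : Paths V r ℓ) (j : V) : ℝ :=
  (Finset.univ.filter fun a : V × Fin r × Fin ℓ => x a.1 a.2.1 a.2.2 = j).card /
    (Fintype.card V * r * ℓ)

/-- The probability that the first `ℓ` nodes of a Markov chain with transition matrix `P` that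
starts in `m` are `y 0, …, y (ℓ - 1)`. -/
def walkProb {ℓ : ℕ} (P : Matrix V V ℝ) (m : V) (y : Fin ℓ → V) : ℝ :=
  ∏ s : Fin ℓ, if (s : ℕ) = 0 then (if y s = m then 1 else 0)
    else P (y ⟨s - 1, lt_of_le_of_lt (Nat.sub_le _ _) s.2⟩) (y s)

/-- The first `ℓ` nodes of all the walks. -/
def prefixes {Ω : Type*} {r : ℕ} (X : V → Fin r → ℕ → Ω → V) (ℓ : ℕ) (ω : Ω) : Paths V r ℓ :=
  fun m p s => X m p s ω

/-- `X` and `Z` are the random quantities of the algorithm with transition matrix `P`, `r` walks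
from each node, window size `w` and negative sampling rate `k`, for all walk lengths `ℓ`:
`X m p` is the (infinite) `p`-th walk from `m`, of which the first `ℓ` nodes are used, and
`Z ℓ a c` is the `c`-th node drawn for the occurrence `a` of a positive pair.
The walks are independent Markov chains with transition matrix `P`, and, given the walks of
length `ℓ`, the nodes `Z ℓ a c` are i.i.d. with the empirical unigram distribution of these walks.
Nothing is required of the joint law of the negative samples for different `ℓ`. -/
structure IsRun {Ω : Type*} [MeasurableSpace Ω] (μ : Measure Ω) (P : Matrix V V ℝ) (r w k : ℕ)
    (X : V → Fin r → ℕ → Ω → V) (Z : (ℓ : ℕ) → PairIdx V r w ℓ → Fin k → Ω → V) : Prop where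
  measurable_walk : ∀ m p s, Measurable[_, ⊤] (X m p s)
  measurable_neg : ∀ ℓ a c, Measurable[_, ⊤] (Z ℓ a c)
  walk_law : ∀ (ℓ : ℕ) (x : Paths V r ℓ),
    μ.real {ω | prefixes X ℓ ω = x} = ∏ m, ∏ p, walkProb P m (x m p)
  neg_law : ∀ (ℓ : ℕ) (x : Paths V r ℓ) (z : PairIdx V r w ℓ → Fin k → V),
    μ.real {ω | prefixes X ℓ ω = x ∧ ∀ a c, Z ℓ a c ω = z a c} =
      μ.real {ω | prefixes X ℓ ω = x} * ∏ a, ∏ c, unigram x (z a c)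

/-- `n_{ij}^+` for walk length `ℓ`. -/
def nPos {Ω : Type*} {r : ℕ} (w : ℕ) (X : V → Fin r → ℕ → Ω → V) (i j : V) (ℓ : ℕ) (ω : Ω) : ℕ :=
  (posMultiset w (prefixes X ℓ ω)).count (i, j)

/-- `n_{ij}^-` for walk length `ℓ`. -/
def nNeg {Ω : Type*} {r w k : ℕ} (X : V → Fin r → ℕ → Ω → V)
    (Z : (ℓ : ℕ) → PairIdx V r w ℓ → Fin k → Ω → V) (i j : V) (ℓ : ℕ) (ω : Ω) : ℕ :=
  (negMultiset (prefixes X ℓ ω) fun a c => Z ℓ a c ω).count (i, j)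

/-- The normalized ergodic limit `(1 / (r n)) * lim_{ℓ → ∞} N ℓ / ℓ` exists almost surely and
equals `a`. -/
def HasErgodicLimit {Ω : Type*} [MeasurableSpace Ω] (μ : Measure Ω) (r n : ℕ)
    (N : ℕ → Ω → ℕ) (a : ℝ) : Prop :=
  ∃ L : ℝ, (∀ᵐ ω ∂μ, Tendsto (fun ℓ : ℕ => (N ℓ ω : ℝ) / (ℓ : ℝ)) atTop (𝓝 L)) ∧
    a = 1 / ((r : ℝ) * (n : ℝ)) * L

end VEC

end

/-!
Since no edge leaves a component, the walks are Markov chains on `V` with the matrix `D⁻¹ A`, and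
only their behaviour in time needs an argument. All almost sure limits come from one law of large
numbers, `tendsto_div_zero_of_mgf_le`: if `E exp (c S_ℓ) ≤ exp (C ℓ c²)` for `|c| ≤ 1`, then
`S_ℓ / ℓ → 0` almost surely, because the Chernoff bounds are summable. It does not relate the sums
for different `ℓ`, as the negative samples require.

*Walks.* By the Markov property, read off from the law of the paths in `IsRun.markov`, a sum of
the centred increments `1{X_{t+1} = j} - P (X_t, j)`, weighted by bounded functions of the history,
has such a bound (`IsRun.tendsto_sum_increment`). With weight `1` this says that every limit point
of the empirical distributions of a walk is invariant. It lives on the component of the starting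
point, where the only invariant distribution is proportional to the degree: the density with
respect to the degree has Dirichlet form zero (`eq_visitFreq_of_invariant`). By compactness the
empirical distributions converge (`tendsto_visits_div`); no aperiodicity is needed. With the
indicator of `X_{t-v} = i` as weight, induction on `v` gives the frequency of pairs at distance
`v` (`IsRun.tendsto_pairVisits`).

*Counts.* `n_{ij}^+` is a sum of such pair counts over the walks and over `v ≤ w`, and averaging
the visit frequencies over the starting points gives `π` (`sum_visitFreq`). Given the walks,
`n_{ij}^-` is a sum of independent variables, so that the same law of large numbers replaces it
by its conditional mean, `k` times the empirical frequency of `j` times `∑_j' n_{ij'}^+`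
(`IsRun.tendsto_nNeg`).
-/

namespace VEC

/-! ### The random walk of a weighted graph -/

section Graph

variable {V : Type*} {A : Matrix V V ℝ}

lemma adj_eq_zero_of_comp_ne (hnonneg : ∀ i j, 0 ≤ A i j) {i j : V}
    (h : comp A j ≠ comp A i) : A i j = 0 := by
  by_contra h0
  refine h (SimpleGraph.ConnectedComponent.sound (SimpleGraph.Adj.reachable ?_))
  have hpos : 0 < A i j := lt_of_le_of_ne (hnonneg i j) (Ne.symm h0)
  exact ⟨fun e => h (by rw [e]), Or.inr hpos⟩

variable [Fintype V]

/-- A sum over the nodes of a component, of a function that vanishes off it. -/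
lemma sum_supp_eq {t : Component A} {f : V → ℝ} (hf : ∀ j, comp A j ≠ t → f j = 0) :
    ∑ j : t.supp, f j = ∑ j, f j := by
  rw [← Finset.sum_subset (Finset.subset_univ (Finset.univ.filter fun j => j ∈ t.supp))]
  · exact (Finset.sum_subtype _ (by simp) f).symm
  · intro j _ hj
    exact hf j fun e => hj (by simpa using e)

lemma compDeg_eq (hnonneg : ∀ i j, 0 ≤ A i j) (t : Component A) (i : t.supp) :
    compDeg A t i = ∑ j, A i j :=
  sum_supp_eq (f := fun j => A i j) fun _ hj =>
    adj_eq_zero_of_comp_ne hnonneg fun e => hj (e.trans i.2)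

lemma compW_apply (hnonneg : ∀ i j, 0 ≤ A i j) (hdeg : ∀ i, 0 < ∑ j, A i j) (t : Component A)
    (i j : t.supp) : compW A t i j = A i j / ∑ l, A i l := by
  have hinv : (Matrix.diagonal (compDeg A t))⁻¹ =
      Matrix.diagonal fun i => (compDeg A t i)⁻¹ := by
    refine Matrix.inv_eq_left_inv ?_
    rw [Matrix.diagonal_mul_diagonal, ← Matrix.diagonal_one]
    congr 1
    funext i
    exact inv_mul_cancel₀ (by rw [compDeg_eq hnonneg]; exact (hdeg i).ne')
  rw [compW, hinv, Matrix.diagonal_mul, compDeg_eq hnonneg, compAdj, Matrix.submatrix_apply,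
    div_eq_inv_mul]

/-- Since no edge leaves a component, the walk on all of `V` has the matrix `D⁻¹ A`. -/
lemma transition_apply (hnonneg : ∀ i j, 0 ≤ A i j) (hdeg : ∀ i, 0 < ∑ j, A i j) (i j : V) :
    transition A i j = A i j / ∑ l, A i l := by
  unfold transition
  split_ifs with h
  · exact compW_apply hnonneg hdeg _ _ _
  · rw [adj_eq_zero_of_comp_ne hnonneg h, zero_div]

lemma transition_nonneg (hnonneg : ∀ i j, 0 ≤ A i j) (hdeg : ∀ i, 0 < ∑ j, A i j) (i j : V) :
    0 ≤ transition A i j := by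
  rw [transition_apply hnonneg hdeg]
  exact div_nonneg (hnonneg i j) (hdeg i).le

lemma transition_row_sum (hnonneg : ∀ i j, 0 ≤ A i j) (hdeg : ∀ i, 0 < ∑ j, A i j) (i : V) :
    ∑ j, transition A i j = 1 := by
  simp_rw [transition_apply hnonneg hdeg]
  rw [← Finset.sum_div, div_self (hdeg i).ne']

lemma transition_of_comp_ne {i j : V} (h : comp A i ≠ comp A j) : transition A i j = 0 :=
  dif_neg fun e => h e.symm

lemma transition_pow_of_comp_ne (v : ℕ) {i j : V} (h : comp A i ≠ comp A j) :
    (transition A ^ v) i j = 0 := by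
  induction v generalizing j with
  | zero => rw [pow_zero, Matrix.one_apply_ne fun e => h (by rw [e])]
  | succ v ih =>
    rw [pow_succ, Matrix.mul_apply]
    refine Finset.sum_eq_zero fun l _ => ?_
    by_cases hl : comp A i = comp A l
    · rw [transition_of_comp_ne (hl ▸ h), mul_zero]
    · rw [ih hl, zero_mul]

lemma transition_pow_row_sum (hnonneg : ∀ i j, 0 ≤ A i j) (hdeg : ∀ i, 0 < ∑ j, A i j)
    (v : ℕ) (i : V) : ∑ j, (transition A ^ v) i j = 1 := by
  induction v with
  | zero => simp [Matrix.one_apply]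
  | succ v ih =>
    simp_rw [pow_succ, Matrix.mul_apply]
    rw [Finset.sum_comm]
    simp_rw [← Finset.mul_sum, transition_row_sum hnonneg hdeg, mul_one, ih]

lemma transition_pow_apply (hnonneg : ∀ i j, 0 ≤ A i j) (hdeg : ∀ i, 0 < ∑ j, A i j)
    (v : ℕ) (t : Component A) (i j : t.supp) :
    (transition A ^ v) i j = (compW A t ^ v) i j := by
  induction v generalizing j with
  | zero => simp [Matrix.one_apply, Subtype.ext_iff]
  | succ v ih =>
    rw [pow_succ, pow_succ, Matrix.mul_apply, Matrix.mul_apply,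
      ← sum_supp_eq (t := t) (f := fun l => (transition A ^ v) i l * transition A l j)]
    · refine Finset.sum_congr rfl fun l _ => ?_
      rw [ih, compW_apply hnonneg hdeg, transition_apply hnonneg hdeg]
    · intro l hl
      rw [transition_of_comp_ne fun e => hl (e.trans j.2), mul_zero]

/-- The limiting frequency of visits to `i` of a walk that starts in `m`: the degree of `i`
relative to the total degree of its component if `m` lies in that component, and else `0`. -/
noncomputable def visitFreq (A : Matrix V V ℝ) (m i : V) : ℝ :=
  if comp A m = comp A i then
    compDeg A (comp A i) ⟨i, rfl⟩ / ∑ i', compDeg A (comp A i) i' else 0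

lemma sum_card_comp (A : Matrix V V ℝ) :
    ∑ t : Component A, (Fintype.card t.supp : ℝ) = Fintype.card V := by
  rw [← Nat.cast_sum, ← Fintype.card_sigma]
  congr 1
  exact Fintype.card_congr (Equiv.sigmaFiberEquiv (comp A))

lemma sum_visitFreq [Nonempty V] (i : V) :
    ∑ m, visitFreq A m i = Fintype.card V * stationary A i := by
  have hcard : (Fintype.card (comp A i).supp : ℝ) =
      ∑ m : V, if comp A m = comp A i then 1 else 0 := by
    rw [Finset.sum_boole, Fintype.card_subtype]
    simp only [SimpleGraph.ConnectedComponent.mem_supp_iff]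
  have hn : (Fintype.card V : ℝ) ≠ 0 := by exact_mod_cast Fintype.card_ne_zero
  unfold stationary visitFreq
  rw [sum_card_comp, hcard, ← mul_assoc, mul_div_cancel₀ _ hn, Finset.sum_mul]
  simp

lemma sum_compDeg_pos (hnonneg : ∀ i j, 0 ≤ A i j) (hdeg : ∀ i, 0 < ∑ j, A i j) (i : V) :
    0 < ∑ i', compDeg A (comp A i) i' :=
  Finset.sum_pos (fun i' _ => by rw [compDeg_eq hnonneg]; exact hdeg i') ⟨⟨i, rfl⟩, by simp⟩

lemma visitFreq_of_comp_eq (hnonneg : ∀ i j, 0 ≤ A i j) {m i : V} (h : comp A i = comp A m) :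
    visitFreq A m i = (∑ j, A i j) / ∑ i', compDeg A (comp A m) i' := by
  rw [visitFreq, if_pos h.symm, compDeg_eq hnonneg]
  exact congrArg (fun t => (∑ j, A i j) / ∑ i', compDeg A t i') h

lemma sum_visitFreq_right (hnonneg : ∀ i j, 0 ≤ A i j) (hdeg : ∀ i, 0 < ∑ j, A i j) (m : V) :
    ∑ i, visitFreq A m i = 1 := by
  rw [← sum_supp_eq (t := comp A m) (f := visitFreq A m)]
  · have h : ∀ i : (comp A m).supp, visitFreq A m i =
        compDeg A (comp A m) i / ∑ i', compDeg A (comp A m) i' := by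
      intro i
      rw [visitFreq_of_comp_eq hnonneg i.2, compDeg_eq hnonneg _ i]
    simp_rw [h]
    rw [← Finset.sum_div, div_self (sum_compDeg_pos hnonneg hdeg m).ne']
  · intro j hj
    exact if_neg (Ne.symm hj)

lemma visitFreq_nonneg (hnonneg : ∀ i j, 0 ≤ A i j) (hdeg : ∀ i, 0 < ∑ j, A i j) (m i : V) :
    0 ≤ visitFreq A m i := by
  unfold visitFreq
  split_ifs
  · exact div_nonneg (by rw [compDeg_eq hnonneg]; exact (hdeg i).le)
      (sum_compDeg_pos hnonneg hdeg i).le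
  · exact le_rfl

/-- Detailed balance for `visitFreq A m`. -/
lemma visitFreq_mul_transition (hsymm : A.IsSymm) (hnonneg : ∀ i j, 0 ≤ A i j)
    (hdeg : ∀ i, 0 < ∑ j, A i j) (m i j : V) :
    visitFreq A m i * transition A i j = visitFreq A m j * transition A j i := by
  by_cases h : comp A i = comp A j
  · rw [transition_apply hnonneg hdeg, transition_apply hnonneg hdeg, hsymm.apply i j]
    have hi := (hdeg i).ne'
    have hj := (hdeg j).ne'
    by_cases hm : comp A i = comp A m
    · rw [visitFreq_of_comp_eq hnonneg hm, visitFreq_of_comp_eq hnonneg (h.symm.trans hm)]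
      field_simp
    · rw [visitFreq, visitFreq, if_neg (Ne.symm hm), if_neg (h ▸ Ne.symm hm), zero_mul, zero_mul]
  · rw [transition_of_comp_ne h, transition_of_comp_ne (Ne.symm h), mul_zero, mul_zero]

lemma visitFreq_vecMul (hsymm : A.IsSymm) (hnonneg : ∀ i j, 0 ≤ A i j)
    (hdeg : ∀ i, 0 < ∑ j, A i j) (m : V) :
    Matrix.vecMul (visitFreq A m) (transition A) = visitFreq A m := by
  funext j
  simp only [Matrix.vecMul, dotProduct]
  simp_rw [fun i => visitFreq_mul_transition hsymm hnonneg hdeg m i j]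
  rw [← Finset.mul_sum, transition_row_sum hnonneg hdeg, mul_one]

/-- `stationary A` is the average of the distributions `visitFreq A m`. -/
lemma stationary_eq [Nonempty V] :
    stationary A = fun i => (Fintype.card V : ℝ)⁻¹ * ∑ m, visitFreq A m i := by
  funext i
  have hn : (Fintype.card V : ℝ) ≠ 0 := by exact_mod_cast Fintype.card_ne_zero
  rw [sum_visitFreq, inv_mul_cancel_left₀ hn]

lemma isStationaryDistribution [Nonempty V] (hsymm : A.IsSymm) (hnonneg : ∀ i j, 0 ≤ A i j)
    (hdeg : ∀ i, 0 < ∑ j, A i j) :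
    IsStationaryDistribution (transition A) (stationary A) := by
  have hn : (Fintype.card V : ℝ) ≠ 0 := by exact_mod_cast Fintype.card_ne_zero
  rw [stationary_eq]
  refine ⟨fun i => ?_, ?_, ?_⟩
  · exact mul_nonneg (by positivity)
      (Finset.sum_nonneg fun m _ => visitFreq_nonneg hnonneg hdeg m i)
  · rw [← Finset.mul_sum, Finset.sum_comm]
    simp_rw [sum_visitFreq_right hnonneg hdeg]
    simp [hn]
  · funext j
    have h := fun m => congrFun (visitFreq_vecMul hsymm hnonneg hdeg m) j
    simp only [Matrix.vecMul, dotProduct] at h ⊢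
    simp_rw [mul_assoc, ← Finset.mul_sum, Finset.sum_mul]
    rw [Finset.sum_comm]
    simp_rw [h]

/-- An invariant vector `p` is a multiple of the degree on each component: its density
`h = p / d` has Dirichlet form `∑ A i j (h i - h j)² = 0`, so `h` is constant along edges. -/
lemma invariant_density_eq (hsymm : A.IsSymm) (hnonneg : ∀ i j, 0 ≤ A i j)
    (hdeg : ∀ i, 0 < ∑ j, A i j) {p : V → ℝ} (hp : Matrix.vecMul p (transition A) = p)
    {i j : V} (hij : comp A i = comp A j) :
    p i / ∑ l, A i l = p j / ∑ l, A j l := by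
  let h : V → ℝ := fun i => p i / ∑ l, A i l
  have hpi : ∀ i, p i = h i * ∑ l, A i l := fun i =>
    (div_mul_cancel₀ _ (hdeg i).ne').symm
  have hinv : ∀ j, ∑ i, h i * A i j = h j * ∑ l, A j l := by
    intro j
    rw [← hpi]
    conv_rhs => rw [← hp]
    simp only [Matrix.vecMul, dotProduct]
    refine Finset.sum_congr rfl fun i _ => ?_
    rw [transition_apply hnonneg hdeg]
    ring
  have hdir : ∑ i, ∑ j, A i j * (h i - h j) ^ 2 = 0 := by
    have e1 : ∑ i, ∑ j, A i j * h i ^ 2 = ∑ i, h i * (h i * ∑ j, A i j) := by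
      refine Finset.sum_congr rfl fun i _ => ?_
      rw [← Finset.sum_mul]; ring
    have e2 : ∑ i, ∑ j, A i j * h j ^ 2 = ∑ i, h i * (h i * ∑ j, A i j) := by
      rw [Finset.sum_comm, ← e1]
      refine Finset.sum_congr rfl fun i _ => Finset.sum_congr rfl fun j _ => ?_
      rw [hsymm.apply i j]
    have e3 : ∑ i, ∑ j, A i j * (h i * h j) = ∑ i, h i * (h i * ∑ j, A i j) := by
      rw [Finset.sum_comm]
      refine Finset.sum_congr rfl fun j _ => ?_
      rw [← hinv, Finset.mul_sum]
      exact Finset.sum_congr rfl fun i _ => by ring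
    calc ∑ i, ∑ j, A i j * (h i - h j) ^ 2
        = ∑ i, ∑ j, A i j * h i ^ 2 + ∑ i, ∑ j, A i j * h j ^ 2
          - 2 * ∑ i, ∑ j, A i j * (h i * h j) := by
          simp_rw [Finset.mul_sum, ← Finset.sum_add_distrib, ← Finset.sum_sub_distrib]
          exact Finset.sum_congr rfl fun i _ => Finset.sum_congr rfl fun j _ => by ring
      _ = 0 := by rw [e1, e2, e3]; ring
  have hzero : ∀ i j, A i j * (h i - h j) ^ 2 = 0 := by
    intro i j
    have hn : ∀ i j, 0 ≤ A i j * (h i - h j) ^ 2 := fun i j =>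
      mul_nonneg (hnonneg i j) (sq_nonneg _)
    have h1 := (Finset.sum_eq_zero_iff_of_nonneg fun i _ =>
      Finset.sum_nonneg fun j _ => hn i j).1 hdir i (Finset.mem_univ i)
    exact (Finset.sum_eq_zero_iff_of_nonneg fun j _ => hn i j).1 h1 j (Finset.mem_univ j)
  have hadj : ∀ i j, 0 < A i j → h i = h j := fun i j hpos => by
    have := (mul_eq_zero.1 (hzero i j)).resolve_left hpos.ne'
    exact sub_eq_zero.1 (pow_eq_zero_iff two_ne_zero |>.1 this)
  obtain ⟨walk⟩ := SimpleGraph.ConnectedComponent.exact hij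
  change h i = h j
  clear hij
  induction walk with
  | nil => rfl
  | cons hab _ ih => exact (hab.2.elim (hadj _ _) fun h' => (hadj _ _ h').symm).trans ih

/-- The restriction of the walk to one component has only one stationary distribution. -/
lemma eq_visitFreq_of_invariant (hsymm : A.IsSymm) (hnonneg : ∀ i j, 0 ≤ A i j)
    (hdeg : ∀ i, 0 < ∑ j, A i j) {p : V → ℝ} {m : V}
    (hp : Matrix.vecMul p (transition A) = p) (hsum : ∑ i, p i = 1)
    (hsupp : ∀ i, comp A i ≠ comp A m → p i = 0) : p = visitFreq A m := by
  -- both sides have a constant density on the component of `m`, and the same total mass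
  let c := p m / ∑ l, A m l
  let c' := visitFreq A m m / ∑ l, A m l
  have hpc : ∀ i, p i = c / c' * visitFreq A m i := by
    intro i
    by_cases hi : comp A i = comp A m
    · have h1 := invariant_density_eq hsymm hnonneg hdeg hp hi
      have h2 := invariant_density_eq hsymm hnonneg hdeg
        (visitFreq_vecMul hsymm hnonneg hdeg m) hi
      have hc' : c' ≠ 0 := by
        refine div_ne_zero ?_ (hdeg m).ne'
        rw [visitFreq_of_comp_eq hnonneg rfl]
        exact div_ne_zero (hdeg m).ne' (sum_compDeg_pos hnonneg hdeg m).ne'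
      rw [div_eq_iff (hdeg i).ne'] at h1 h2
      rw [h1, h2]
      change c * _ = c / c' * (c' * _)
      field_simp
    · rw [hsupp i hi, visitFreq, if_neg (Ne.symm hi), mul_zero]
  have h1 : c / c' = 1 := by
    have := hsum
    simp_rw [hpc] at this
    rwa [← Finset.mul_sum, sum_visitFreq_right hnonneg hdeg, mul_one] at this
  funext i
  rw [hpc, h1, one_mul]

end Graph

/-! ### Exponential moments and laws of large numbers -/

section Moments

lemma exp_mul_le {c x : ℝ} (hc : |c| ≤ 1) (hx : |x| ≤ 1) :
    Real.exp (c * x) ≤ 1 + c * x + c ^ 2 := by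
  have hcx : |c * x| ≤ 1 := by
    rw [abs_mul]
    exact mul_le_one₀ hc (abs_nonneg _) hx
  have h1 := (abs_le.1 (Real.abs_exp_sub_one_sub_id_le hcx)).2
  have h2 : (c * x) ^ 2 ≤ c ^ 2 := by
    rw [mul_pow]
    exact mul_le_of_le_one_right (sq_nonneg _) ((sq_le_one_iff_abs_le_one _).2 hx)
  linarith

variable {Ω : Type*} [MeasurableSpace Ω] {μ : Measure Ω}

lemma integrable_comp_of_finite [IsFiniteMeasure μ] {α : Type*} [Finite α] {Y : Ω → α}
    (hY : ∀ x, MeasurableSet {ω | Y ω = x}) (F : α → ℝ) : Integrable (fun ω => F (Y ω)) μ := by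
  let _ : MeasurableSpace α := ⊤
  have hm : Measurable Y := measurable_to_countable' fun x => hY x
  exact (Integrable.of_finite (f := F) (μ := μ.map Y)).comp_measurable hm

lemma integral_comp_eq_sum [IsFiniteMeasure μ] {α : Type*} [Fintype α] {Y : Ω → α}
    (hY : ∀ x, MeasurableSet {ω | Y ω = x}) (F : α → ℝ) :
    ∫ ω, F (Y ω) ∂μ = ∑ x, μ.real {ω | Y ω = x} * F x := by
  let _ : MeasurableSpace α := ⊤
  have hm : Measurable Y := measurable_to_countable' fun x => hY x
  rw [← integral_map (f := F) hm.aemeasurable (by measurability),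
    integral_fintype Integrable.of_finite]
  refine Finset.sum_congr rfl fun x _ => ?_
  rw [map_measureReal_apply hm (MeasurableSet.of_discrete), smul_eq_mul]
  rfl

/-- A law of large numbers for sums `S ℓ` with a Gaussian bound on the exponential moments near
`0`: the Chernoff bounds for `|S ℓ| ≥ ε ℓ` are summable. The sums for different `ℓ` need not be
related. -/
lemma tendsto_div_zero_of_mgf_le {S : ℕ → Ω → ℝ} {C : ℝ} (hC : 0 < C)
    (hint : ∀ ℓ c, Integrable (fun ω => Real.exp (c * S ℓ ω)) μ) [IsFiniteMeasure μ]
    (hmgf : ∀ (ℓ : ℕ) (c : ℝ), |c| ≤ 1 →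
      ∫ ω, Real.exp (c * S ℓ ω) ∂μ ≤ Real.exp (C * ℓ * c ^ 2)) :
    ∀ᵐ ω ∂μ, Tendsto (fun ℓ : ℕ => S ℓ ω / ℓ) atTop (𝓝 0) := by
  have key : ∀ ε : ℝ, 0 < ε → ∀ᵐ ω ∂μ, ∀ᶠ ℓ : ℕ in atTop, |S ℓ ω| < ε * ℓ := by
    intro ε hε
    -- this `c` is admissible, and `C * c ^ 2 ≤ c * ε / 2`
    set c : ℝ := min 1 (ε / (2 * C)) with hc
    have hc0 : 0 < c := lt_min one_pos (by positivity)
    have hc1 : c ≤ 1 := min_le_left _ _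
    have hcC : C * c ≤ ε / 2 := by
      have := min_le_right 1 (ε / (2 * C))
      rw [← hc, le_div_iff₀ (by positivity)] at this
      linarith
    have hbound : ∀ ℓ : ℕ, Real.exp (-(c * (ε * ℓ))) * Real.exp (C * ℓ * c ^ 2) ≤
        Real.exp (-(c * ε / 2)) ^ ℓ := by
      intro ℓ
      rw [← Real.exp_add, ← Real.exp_nat_mul]
      refine Real.exp_le_exp.2 ?_
      have := mul_le_mul_of_nonneg_left hcC (mul_nonneg hc0.le (Nat.cast_nonneg (α := ℝ) ℓ))
      linarith
    have htail : ∀ ℓ : ℕ, μ.real {ω | ε * ℓ ≤ |S ℓ ω|} ≤ 2 * Real.exp (-(c * ε / 2)) ^ ℓ := by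
      intro ℓ
      have h1 := ProbabilityTheory.measure_ge_le_exp_mul_mgf (μ := μ) (X := S ℓ) (ε * ℓ) hc0.le
        (hint ℓ c)
      have h2 := ProbabilityTheory.measure_le_le_exp_mul_mgf (μ := μ) (X := S ℓ) (-(ε * ℓ))
        (neg_nonpos.2 hc0.le) (hint ℓ (-c))
      have h3 := hmgf ℓ c (by rwa [abs_of_pos hc0])
      have h4 := hmgf ℓ (-c) (by rwa [abs_neg, abs_of_pos hc0])
      rw [neg_sq] at h4
      have hsub : {ω | ε * ℓ ≤ |S ℓ ω|} ⊆ {ω | ε * ℓ ≤ S ℓ ω} ∪ {ω | S ℓ ω ≤ -(ε * ℓ)} := by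
        intro ω hω
        rcases le_abs'.1 (show ε * ℓ ≤ |S ℓ ω| from hω) with h | h
        · exact Or.inr h
        · exact Or.inl h
      calc μ.real {ω | ε * ℓ ≤ |S ℓ ω|}
          ≤ μ.real {ω | ε * ℓ ≤ S ℓ ω} + μ.real {ω | S ℓ ω ≤ -(ε * ℓ)} :=
            (measureReal_mono hsub).trans (measureReal_union_le _ _)
        _ ≤ Real.exp (-(c * (ε * ℓ))) * Real.exp (C * ℓ * c ^ 2) +
            Real.exp (-(c * (ε * ℓ))) * Real.exp (C * ℓ * c ^ 2) := by
            refine add_le_add (h1.trans ?_) (h2.trans ?_)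
            · rw [neg_mul]
              exact mul_le_mul_of_nonneg_left h3 (Real.exp_pos _).le
            · rw [neg_neg, mul_neg]
              exact mul_le_mul_of_nonneg_left h4 (Real.exp_pos _).le
        _ ≤ 2 * Real.exp (-(c * ε / 2)) ^ ℓ := by linarith [hbound ℓ]
    have hsum : Summable fun ℓ : ℕ => 2 * Real.exp (-(c * ε / 2)) ^ ℓ := by
      refine (summable_geometric_of_lt_one (Real.exp_pos _).le ?_).mul_left _
      rw [Real.exp_lt_one_iff]
      have : 0 < c * ε := mul_pos hc0 hε
      linarith
    have hfin : ∑' ℓ : ℕ, μ {ω | ε * ℓ ≤ |S ℓ ω|} ≠ ⊤ := by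
      refine ne_top_of_le_ne_top hsum.tsum_ofReal_ne_top (ENNReal.tsum_le_tsum fun ℓ => ?_)
      rw [← ofReal_measureReal]
      exact ENNReal.ofReal_le_ofReal (htail ℓ)
    filter_upwards [ae_eventually_notMem hfin] with ω hω
    exact hω.mono fun ℓ h => not_le.1 h
  have hall : ∀ᵐ ω ∂μ, ∀ n : ℕ, ∀ᶠ ℓ : ℕ in atTop, |S ℓ ω| < 1 / ((n : ℝ) + 1) * ℓ :=
    ae_all_iff.2 fun n => key _ (by positivity)
  filter_upwards [hall] with ω hω
  rw [Metric.tendsto_nhds]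
  intro ε hε
  obtain ⟨n, hn⟩ := exists_nat_one_div_lt hε
  filter_upwards [hω n, eventually_gt_atTop 0] with ℓ hℓ hpos
  have hpos' : (0 : ℝ) < ℓ := by exact_mod_cast hpos
  rw [dist_zero_right, Real.norm_eq_abs, abs_div, abs_of_pos hpos', div_lt_iff₀ hpos']
  exact hℓ.trans (mul_lt_mul_of_pos_right hn hpos')

end Moments

/-! ### The walks as martingales -/

section Walks

lemma prod_prod_sum {ι κ α R : Type*} [Fintype ι] [DecidableEq ι] [Fintype κ] [DecidableEq κ]
    [Fintype α] [CommSemiring R]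
    (f : ι → κ → α → R) :
    ∏ a, ∏ c, ∑ v, f a c v = ∑ z : ι → κ → α, ∏ a, ∏ c, f a c (z a c) := by
  simp_rw [Finset.prod_univ_sum, Fintype.piFinset_univ]

/-- For a product of probability vectors `Q a c`, the marginal law of the coordinate `(m, p)`. -/
lemma sum_ite_prod_prod {ι κ α : Type*} [Fintype ι] [DecidableEq ι] [Fintype κ] [DecidableEq κ]
    [Fintype α]
    (Q : ι → κ → α → ℝ) (hQ : ∀ a c, ∑ v, Q a c v = 1) (m : ι) (p : κ) (j : α) :
    ∑ y : ι → κ → α, (if y m p = j then ∏ a, ∏ c, Q a c (y a c) else 0) = Q m p j := by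
  let f : ι → κ → α → ℝ := fun a c v => if a = m ∧ c = p ∧ v ≠ j then 0 else Q a c v
  have hf : ∀ a c, ¬ (a = m ∧ c = p) → ∑ v, f a c v = 1 := fun a c hac => by
    rw [← hQ a c]
    exact Finset.sum_congr rfl fun v _ => if_neg fun h => hac ⟨h.1, h.2.1⟩
  have h1 : ∀ y : ι → κ → α, (if y m p = j then ∏ a, ∏ c, Q a c (y a c) else 0) =
      ∏ a, ∏ c, f a c (y a c) := by
    intro y
    by_cases hy : y m p = j
    · rw [if_pos hy]
      refine Finset.prod_congr rfl fun a _ => Finset.prod_congr rfl fun c _ => ?_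
      refine (if_neg ?_).symm
      rintro ⟨rfl, rfl, h3⟩
      exact h3 hy
    · rw [if_neg hy]
      refine (Finset.prod_eq_zero (Finset.mem_univ m)
        (Finset.prod_eq_zero (Finset.mem_univ p) ?_)).symm
      exact if_pos ⟨rfl, rfl, hy⟩
  have h2 : ∑ v, f m p v = Q m p j := by
    rw [Finset.sum_eq_single j]
    · exact if_neg fun h => h.2.2 rfl
    · intro v _ hv
      exact if_pos ⟨rfl, rfl, hv⟩
    · exact fun h => absurd (Finset.mem_univ _) h
  simp_rw [h1]
  rw [← prod_prod_sum, Finset.prod_eq_single m, Finset.prod_eq_single p, h2]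
  · exact fun c _ hc => hf m c fun h => hc h.2
  · exact fun h => absurd (Finset.mem_univ _) h
  · exact fun a _ ha => Finset.prod_eq_one fun c _ => hf a c fun h => ha h.1
  · exact fun h => absurd (Finset.mem_univ _) h

variable {V : Type*} {Ω : Type*} [MeasurableSpace Ω] {μ : Measure Ω}
  {P : Matrix V V ℝ} {r w k : ℕ} {X : V → Fin r → ℕ → Ω → V}

lemma walkProb_snoc {t : ℕ} (m : V) (y : Fin (t + 1) → V) (v : V) :
    walkProb P m (Fin.snoc y v : Fin (t + 2) → V) =
      walkProb P m y * P (y (Fin.last t)) v := by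
  unfold walkProb
  rw [Fin.prod_univ_castSucc]
  congr 1
  · refine Finset.prod_congr rfl fun s _ => ?_
    have h : ∀ h', (Fin.snoc y v : Fin (t + 2) → V) ⟨(s : ℕ) - 1, h'⟩ =
        y ⟨s - 1, lt_of_le_of_lt (Nat.sub_le _ _) s.2⟩ := fun h' =>
      Fin.snoc_castSucc (α := fun _ => V) v y ⟨s - 1, lt_of_le_of_lt (Nat.sub_le _ _) s.2⟩
    simp only [Fin.snoc_castSucc, Fin.val_castSucc, h]
  · have h : ∀ h', (Fin.snoc y v : Fin (t + 2) → V) ⟨t + 1 - 1, h'⟩ = y (Fin.last t) := fun h' =>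
      Fin.snoc_castSucc (α := fun _ => V) v y (Fin.last t)
    simp only [Fin.val_last, Nat.add_eq_zero_iff, one_ne_zero, and_false, if_false,
      Fin.snoc_last, h]

variable [Fintype V] {Z : (ℓ : ℕ) → PairIdx V r w ℓ → Fin k → Ω → V}

lemma IsRun.measurableSet_walk (h : IsRun μ P r w k X Z) (m : V) (p : Fin r) (s : ℕ) (v : V) :
    MeasurableSet {ω | X m p s ω = v} :=
  h.measurable_walk m p s (show MeasurableSet[⊤] ({v} : Set V) from trivial)

lemma IsRun.measurableSet_prefixes (h : IsRun μ P r w k X Z) (ℓ : ℕ) (x : Paths V r ℓ) :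
    MeasurableSet {ω | prefixes X ℓ ω = x} := by
  have : {ω | prefixes X ℓ ω = x} = ⋂ m, ⋂ p, ⋂ s : Fin ℓ, {ω | X m p s ω = x m p s} := by
    ext ω
    simp [funext_iff, prefixes]
  rw [this]
  exact MeasurableSet.iInter fun m => MeasurableSet.iInter fun p => MeasurableSet.iInter fun s =>
    h.measurableSet_walk m p s _

lemma IsRun.measurableSet_prefixes_walk (h : IsRun μ P r w k X Z) (ℓ : ℕ) (m : V) (p : Fin r)
    (s : ℕ) (x : Paths V r ℓ × V) :
    MeasurableSet {ω | (prefixes X ℓ ω, X m p s ω) = x} := by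
  simp_rw [Prod.ext_iff]
  exact (h.measurableSet_prefixes ℓ x.1).inter (h.measurableSet_walk m p s x.2)

/-- The Markov property: given the history of all the walks up to time `t`, the walk `(m, p)`
moves by `P`. -/
lemma IsRun.markov [IsFiniteMeasure μ] (h : IsRun μ P r w k X Z) (hrow : ∀ i, ∑ j, P i j = 1)
    (m : V) (p : Fin r) (t : ℕ) (x : Paths V r (t + 1)) (j : V) :
    μ.real {ω | prefixes X (t + 1) ω = x ∧ X m p (t + 1) ω = j} =
      μ.real {ω | prefixes X (t + 1) ω = x} * P (x m p (Fin.last t)) j := by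
  let ext : (V → Fin r → V) → Paths V r (t + 2) := fun y m p => Fin.snoc (x m p) (y m p)
  have hext : ∀ (y : V → Fin r → V) (ω : Ω), prefixes X (t + 2) ω = ext y ↔
      prefixes X (t + 1) ω = x ∧ ∀ m p, X m p (t + 1) ω = y m p := by
    intro y ω
    simp only [funext_iff, ← forall_and]
    refine forall_congr' fun m => forall_congr' fun p => ?_
    rw [Fin.forall_fin_succ']
    simp [prefixes, ext]
  have hsplit : {ω | prefixes X (t + 1) ω = x ∧ X m p (t + 1) ω = j} =
      ⋃ y ∈ Finset.univ.filter (fun y : V → Fin r → V => y m p = j),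
        {ω | prefixes X (t + 2) ω = ext y} := by
    ext ω
    simp only [Set.mem_ofPred_eq, Set.mem_iUnion, hext, Finset.mem_filter, Finset.mem_univ,
      true_and, exists_prop]
    constructor
    · rintro ⟨h1, h2⟩
      exact ⟨fun m p => X m p (t + 1) ω, h2, h1, fun _ _ => rfl⟩
    · rintro ⟨y, hy, h1, h2⟩
      exact ⟨h1, (h2 m p).trans hy⟩
  rw [hsplit, measureReal_biUnion_finset]
  · have hprob : ∀ y : V → Fin r → V, μ.real {ω | prefixes X (t + 2) ω = ext y} =
        μ.real {ω | prefixes X (t + 1) ω = x} * ∏ m, ∏ p, P (x m p (Fin.last t)) (y m p) := by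
      intro y
      rw [h.walk_law, h.walk_law, ← Finset.prod_mul_distrib]
      refine Finset.prod_congr rfl fun m _ => ?_
      rw [← Finset.prod_mul_distrib]
      exact Finset.prod_congr rfl fun p _ => walkProb_snoc _ _ _
    simp_rw [hprob]
    rw [← Finset.mul_sum, Finset.sum_filter]
    congr 1
    exact sum_ite_prod_prod (fun m p v => P (x m p (Fin.last t)) v) (fun _ _ => hrow _) m p j
  · intro y _ y' _ hne
    refine Set.disjoint_left.2 fun ω h1 h2 => hne ?_
    have e1 := ((hext y ω).1 h1).2
    have e2 := ((hext y' ω).1 h2).2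
    funext m p
    rw [← e1, e2]
  · exact fun y _ => h.measurableSet_prefixes _ _

/-- The increment of the walk `(m, p)` at time `t` for the test function `1_j`, centred by its
conditional mean. -/
noncomputable def increment (P : Matrix V V ℝ) (X : V → Fin r → ℕ → Ω → V) (m : V) (p : Fin r)
    (j : V) (t : ℕ) (ω : Ω) : ℝ :=
  (if X m p (t + 1) ω = j then 1 else 0) - P (X m p t ω) j

lemma IsRun.integral_mul_increment [IsFiniteMeasure μ] (h : IsRun μ P r w k X Z)
    (hrow : ∀ i, ∑ j, P i j = 1) (m : V) (p : Fin r) (j : V) (t : ℕ)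
    (F : Paths V r (t + 1) → ℝ) :
    ∫ ω, F (prefixes X (t + 1) ω) * increment P X m p j t ω ∂μ = 0 := by
  have h1 := integral_comp_eq_sum (μ := μ) (h.measurableSet_prefixes_walk (t + 1) m p (t + 1))
    (fun x => F x.1 * ((if x.2 = j then 1 else 0) - P (x.1 m p (Fin.last t)) j))
  refine h1.trans ?_
  rw [Fintype.sum_prod_type]
  refine Finset.sum_eq_zero fun x _ => ?_
  simp only [Prod.mk.injEq, h.markov hrow]
  have h2 : ∑ v, P (x m p (Fin.last t)) v *
      ((if v = j then 1 else 0) - P (x m p (Fin.last t)) j) = 0 := by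
    simp [mul_sub, ← Finset.sum_mul, hrow]
  calc _ = μ.real {ω | prefixes X (t + 1) ω = x} * F x * ∑ v, P (x m p (Fin.last t)) v *
      ((if v = j then 1 else 0) - P (x m p (Fin.last t)) j) := by
        rw [Finset.mul_sum]
        exact Finset.sum_congr rfl fun v _ => by ring
    _ = 0 := by rw [h2, mul_zero]

/-- A sum of bounded martingale differences: the weight `g t` depends on the walks up to
time `t` only. -/
lemma IsRun.tendsto_sum_increment [IsProbabilityMeasure μ] (h : IsRun μ P r w k X Z)
    (hP : ∀ i j, 0 ≤ P i j) (hrow : ∀ i, ∑ j, P i j = 1) (m : V) (p : Fin r) (j : V)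
    {g : ℕ → Ω → ℝ} (hg : ∀ t, Function.FactorsThrough (g t) (prefixes X (t + 1)))
    (hg1 : ∀ t ω, |g t ω| ≤ 1) :
    ∀ᵐ ω ∂μ, Tendsto (fun ℓ : ℕ =>
      (∑ t ∈ Finset.range ℓ, g t ω * increment P X m p j t ω) / ℓ) atTop (𝓝 0) := by
  have hP1 : ∀ i j, P i j ≤ 1 := fun i j =>
    (hrow i) ▸ Finset.single_le_sum (fun j _ => hP i j) (Finset.mem_univ j)
  let S : ℕ → Ω → ℝ := fun ℓ ω => ∑ t ∈ Finset.range ℓ, g t ω * increment P X m p j t ω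
  have hfac : ∀ t, ∃ φ : Paths V r (t + 1) → ℝ, ∀ ω, g t ω = φ (prefixes X (t + 1) ω) :=
    fun t => ⟨Function.extend (prefixes X (t + 1)) (g t) 0, fun ω =>
      ((hg t).extend_apply 0 ω).symm⟩
  have hS : ∀ ℓ, ∃ φ : Paths V r (ℓ + 1) → ℝ, ∀ ω, S ℓ ω = φ (prefixes X (ℓ + 1) ω) := by
    intro ℓ
    have : Function.FactorsThrough (S ℓ) (prefixes X (ℓ + 1)) := by
      intro ω ω' hω
      have hX : ∀ s, s < ℓ + 1 → ∀ m p, X m p s ω = X m p s ω' := fun s hs m p =>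
        congrFun (congrFun (congrFun hω m) p) ⟨s, hs⟩
      refine Finset.sum_congr rfl fun t ht => ?_
      have ht' := Finset.mem_range.1 ht
      have hgt : g t ω = g t ω' := hg t <| by
        funext m p s
        exact hX s (by omega) m p
      rw [hgt, increment, increment, hX (t + 1) (by omega), hX t (by omega)]
    exact ⟨Function.extend (prefixes X (ℓ + 1)) (S ℓ) 0, fun ω => (this.extend_apply 0 ω).symm⟩
  have hint : ∀ ℓ c, Integrable (fun ω => Real.exp (c * S ℓ ω)) μ := by
    intro ℓ c
    obtain ⟨φ, hφ⟩ := hS ℓ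
    simp_rw [hφ]
    exact integrable_comp_of_finite (h.measurableSet_prefixes (ℓ + 1)) fun x => Real.exp (c * φ x)
  refine tendsto_div_zero_of_mgf_le (S := S) one_pos hint fun ℓ c hc => ?_
  have hrec : ∀ ℓ, ∫ ω, Real.exp (c * S (ℓ + 1) ω) ∂μ ≤
      (1 + c ^ 2) * ∫ ω, Real.exp (c * S ℓ ω) ∂μ := by
    intro ℓ
    obtain ⟨φ, hφ⟩ := hS ℓ
    obtain ⟨γ, hγ⟩ := hfac ℓ
    have hzero := h.integral_mul_increment hrow m p j ℓ
      fun x => Real.exp (c * φ x) * (c * γ x)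
    have hint2 : Integrable (fun ω => Real.exp (c * φ (prefixes X (ℓ + 1) ω)) *
        (c * γ (prefixes X (ℓ + 1) ω)) * increment P X m p j ℓ ω) μ :=
      integrable_comp_of_finite (h.measurableSet_prefixes_walk (ℓ + 1) m p (ℓ + 1))
        fun x => Real.exp (c * φ x.1) * (c * γ x.1) *
          ((if x.2 = j then 1 else 0) - P (x.1 m p (Fin.last ℓ)) j)
    have hint1 := (hint ℓ c).const_mul (1 + c ^ 2)
    calc ∫ ω, Real.exp (c * S (ℓ + 1) ω) ∂μ
        ≤ ∫ ω, ((1 + c ^ 2) * Real.exp (c * S ℓ ω) +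
          Real.exp (c * φ (prefixes X (ℓ + 1) ω)) *
            (c * γ (prefixes X (ℓ + 1) ω)) * increment P X m p j ℓ ω) ∂μ := by
          refine integral_mono (hint _ _) (hint1.add hint2) fun ω => ?_
          have hinc : |increment P X m p j ℓ ω| ≤ 1 := by
            have h0 := hP (X m p ℓ ω) j
            have h1 := hP1 (X m p ℓ ω) j
            unfold increment
            rw [abs_le]
            split_ifs <;> constructor <;> linarith
          have hle := exp_mul_le hc (x := g ℓ ω * increment P X m p j ℓ ω) <| by
            rw [abs_mul]
            exact mul_le_one₀ (hg1 ℓ ω) (abs_nonneg _) hinc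
          have := mul_le_mul_of_nonneg_left hle (Real.exp_pos (c * S ℓ ω)).le
          have hSs : S (ℓ + 1) ω = S ℓ ω + g ℓ ω * increment P X m p j ℓ ω :=
            Finset.sum_range_succ _ _
          simp only [← hφ, ← hγ]
          rw [hSs, mul_add, Real.exp_add]
          linarith
      _ = (1 + c ^ 2) * ∫ ω, Real.exp (c * S ℓ ω) ∂μ := by
          rw [integral_add hint1 hint2, hzero, add_zero, integral_const_mul]
  have hpow : ∀ ℓ, ∫ ω, Real.exp (c * S ℓ ω) ∂μ ≤ (1 + c ^ 2) ^ ℓ := by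
    intro ℓ
    induction ℓ with
    | zero => simp [S]
    | succ ℓ ih =>
      rw [pow_succ']
      exact (hrec ℓ).trans (mul_le_mul_of_nonneg_left ih (by positivity))
  calc ∫ ω, Real.exp (c * S ℓ ω) ∂μ ≤ (1 + c ^ 2) ^ ℓ := hpow ℓ
    _ ≤ Real.exp (c ^ 2) ^ ℓ := by
        gcongr
        linarith [Real.add_one_le_exp (c ^ 2)]
    _ = Real.exp (1 * ℓ * c ^ 2) := by rw [← Real.exp_nat_mul, one_mul]

end Walks

/-! ### Visit frequencies -/

section Sequences

lemma tendsto_shift_div {f : ℕ → ℝ} {L : ℝ} (v : ℕ)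
    (h : Tendsto (fun ℓ : ℕ => f ℓ / ℓ) atTop (𝓝 L)) :
    Tendsto (fun ℓ : ℕ => f (ℓ - v) / ℓ) atTop (𝓝 L) := by
  rw [← tendsto_add_atTop_iff_nat v]
  have h2 := h.mul (tendsto_natCast_div_add_atTop (𝕜 := ℝ) (v : ℝ))
  rw [mul_one] at h2
  refine h2.congr' ?_
  filter_upwards [eventually_gt_atTop 0] with ℓ hℓ
  have : (ℓ : ℝ) ≠ 0 := by exact_mod_cast hℓ.ne'
  rw [Nat.add_sub_cancel, Nat.cast_add, div_mul_div_cancel₀ this]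

lemma tendsto_zero_of_shift_div {f : ℕ → ℝ} (v : ℕ)
    (h : Tendsto (fun ℓ : ℕ => f ℓ / ((ℓ + v : ℕ) : ℝ)) atTop (𝓝 0)) :
    Tendsto (fun ℓ : ℕ => f ℓ / ℓ) atTop (𝓝 0) := by
  have h1 := (tendsto_natCast_div_add_atTop (𝕜 := ℝ) (v : ℝ)).inv₀ one_ne_zero
  have h2 := h.mul h1
  rw [zero_mul] at h2
  refine h2.congr' ?_
  filter_upwards [eventually_gt_atTop 0] with ℓ hℓ
  have : (ℓ : ℝ) ≠ 0 := by exact_mod_cast hℓ.ne'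
  have : ((ℓ : ℝ) + v) ≠ 0 := by positivity
  rw [Nat.cast_add]
  field_simp

lemma mapClusterPt_eq_of_tendsto {α E F : Type*} [TopologicalSpace E] [TopologicalSpace F]
    [T2Space F] {l : Filter α} {f : α → E} {y : E} {G : E → F} {c : F}
    (hy : MapClusterPt y l f) (hG : Continuous G) (h : Tendsto (fun a => G (f a)) l (𝓝 c)) :
    G y = c := by
  have h1 : MapClusterPt (G y) l (G ∘ f) := hy.continuousAt_comp hG.continuousAt
  have h2 : (𝓝 (G y) ⊓ 𝓝 c).NeBot := h1.neBot.mono (inf_le_inf_left _ h)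
  exact eq_of_nhds_neBot h2

variable {V : Type*} [Fintype V] {A : Matrix V V ℝ}

/-- A sequence in the component of `m` that moves asymptotically like the walk visits `i` with the
frequency `visitFreq A m i`: a limit point of the empirical distributions is a stationary
distribution on the component, and there is only one. -/
lemma tendsto_visits_div (hsymm : A.IsSymm) (hnonneg : ∀ i j, 0 ≤ A i j)
    (hdeg : ∀ i, 0 < ∑ j, A i j) {m : V} {x : ℕ → V} (hx : ∀ t, comp A (x t) = comp A m)
    (hmove : ∀ j, Tendsto (fun ℓ : ℕ => (∑ t ∈ Finset.range ℓ,
      ((if x (t + 1) = j then 1 else 0) - transition A (x t) j)) / ℓ) atTop (𝓝 0)) (i : V) :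
    Tendsto (fun ℓ : ℕ => (∑ t ∈ Finset.range ℓ, if x t = i then (1 : ℝ) else 0) / ℓ) atTop
      (𝓝 (visitFreq A m i)) := by
  let F : ℕ → V → ℝ := fun ℓ i => (∑ t ∈ Finset.range ℓ, if x t = i then (1 : ℝ) else 0) / ℓ
  suffices h : Tendsto F atTop (𝓝 (visitFreq A m)) from (tendsto_pi_nhds.1 h) i
  refine (isCompact_Icc (a := (0 : V → ℝ)) (b := 1)).tendsto_nhds_of_unique_mapClusterPt
    (Eventually.of_forall fun ℓ => ⟨fun i => ?_, fun i => ?_⟩) fun y _ hy => ?_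
  · exact div_nonneg (Finset.sum_nonneg fun t _ => by split_ifs <;> norm_num) (Nat.cast_nonneg _)
  · refine div_le_one_of_le₀ ?_ (Nat.cast_nonneg _)
    calc ∑ t ∈ Finset.range ℓ, (if x t = i then (1 : ℝ) else 0)
        ≤ ∑ t ∈ Finset.range ℓ, (1 : ℝ) := Finset.sum_le_sum fun t _ => by split_ifs <;> norm_num
      _ = ℓ := by simp
  refine eq_visitFreq_of_invariant hsymm hnonneg hdeg ?_ ?_ ?_
  · funext j
    refine sub_eq_zero.1 (mapClusterPt_eq_of_tendsto
      (G := fun y : V → ℝ => Matrix.vecMul y (transition A) j - y j) hy ?_ ?_)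
    · simp only [Matrix.vecMul, dotProduct]
      fun_prop
    -- the two sides differ by the centred increments and by the end points
    · have h1 := (hmove j).neg
      have h2 : Tendsto (fun ℓ : ℕ => ((if x ℓ = j then 1 else 0) - if x 0 = j then 1 else 0) /
          (ℓ : ℝ)) atTop (𝓝 0) := by
        refine squeeze_zero_norm (fun ℓ => ?_) tendsto_one_div_atTop_nhds_zero_nat
        rw [norm_div, Real.norm_natCast]
        refine div_le_div_of_nonneg_right ?_ (Nat.cast_nonneg _)
        split_ifs <;> norm_num
      have h3 := h1.add h2
      rw [neg_zero, zero_add] at h3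
      refine h3.congr fun ℓ => ?_
      have e1 : ∑ t ∈ Finset.range ℓ, transition A (x t) j =
          ∑ i, (∑ t ∈ Finset.range ℓ, if x t = i then (1 : ℝ) else 0) * transition A i j := by
        simp_rw [Finset.sum_mul]
        rw [Finset.sum_comm]
        simp
      have e2 := Finset.sum_range_sub (fun t => if x t = j then (1 : ℝ) else 0) ℓ
      rw [Finset.sum_sub_distrib] at e2
      have e3 : Matrix.vecMul (F ℓ) (transition A) j =
          (∑ t ∈ Finset.range ℓ, transition A (x t) j) / ℓ := by
        rw [e1, Finset.sum_div]
        simp only [Matrix.vecMul, dotProduct, F]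
        exact Finset.sum_congr rfl fun i _ => by ring
      rw [e3, Finset.sum_sub_distrib, ← neg_div, ← add_div, ← sub_div]
      congr 1
      linarith
  · refine mapClusterPt_eq_of_tendsto (G := fun y : V → ℝ => ∑ i, y i) hy (by fun_prop) ?_
    refine tendsto_const_nhds.congr' ?_
    filter_upwards [eventually_gt_atTop 0] with ℓ hℓ
    have hℓ' : (ℓ : ℝ) ≠ 0 := by exact_mod_cast hℓ.ne'
    simp only [F]
    rw [← Finset.sum_div, Finset.sum_comm]
    simp [hℓ']
  · intro i hi
    refine mapClusterPt_eq_of_tendsto (G := fun y : V → ℝ => y i) hy (by fun_prop) ?_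
    refine tendsto_const_nhds.congr fun ℓ => ?_
    have : ∀ t, x t ≠ i := fun t e => hi (e ▸ hx t)
    simp [F, this]

end Sequences

section Visits

variable {V : Type*} [Fintype V] {A : Matrix V V ℝ} {Ω : Type*} [MeasurableSpace Ω]
  {μ : Measure Ω} [IsProbabilityMeasure μ] {r w k : ℕ} {X : V → Fin r → ℕ → Ω → V}
  {Z : (ℓ : ℕ) → PairIdx V r w ℓ → Fin k → Ω → V}

lemma IsRun.ae_comp_eq (h : IsRun μ (transition A) r w k X Z) (hnonneg : ∀ i j, 0 ≤ A i j)
    (hdeg : ∀ i, 0 < ∑ j, A i j) (m : V) (p : Fin r) :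
    ∀ᵐ ω ∂μ, ∀ t, comp A (X m p t ω) = comp A m := by
  have hstart : ∀ᵐ ω ∂μ, X m p 0 ω = m := by
    have hx : ∀ᵐ ω ∂μ, ∀ x : Paths V r 1, x m p 0 ≠ m → prefixes X 1 ω ≠ x := by
      refine ae_all_iff.2 fun x => ?_
      by_cases hxm : x m p 0 = m
      · exact Eventually.of_forall fun ω hne => absurd hxm hne
      · have h0 : μ.real {ω | prefixes X 1 ω = x} = 0 := by
          rw [h.walk_law]
          refine Finset.prod_eq_zero (Finset.mem_univ m)
            (Finset.prod_eq_zero (Finset.mem_univ p) ?_)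
          refine Finset.prod_eq_zero (Finset.mem_univ 0) ?_
          simp [hxm]
        have h1 := measure_eq_zero_iff_ae_notMem.1 ((measureReal_eq_zero_iff).1 h0)
        filter_upwards [h1] with ω hω _ using hω
    filter_upwards [hx] with ω hω
    by_contra hne
    exact hω (prefixes X 1 ω) hne rfl
  have hstep : ∀ᵐ ω ∂μ, ∀ t, transition A (X m p t ω) (X m p (t + 1) ω) ≠ 0 := by
    refine ae_all_iff.2 fun t => ?_
    have hx : ∀ᵐ ω ∂μ, ∀ (x : Paths V r (t + 1)) (j : V), transition A (x m p (Fin.last t)) j = 0 →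
        ¬ (prefixes X (t + 1) ω = x ∧ X m p (t + 1) ω = j) := by
      refine ae_all_iff.2 fun x => ae_all_iff.2 fun j => ?_
      by_cases hxj : transition A (x m p (Fin.last t)) j = 0
      · have h0 := h.markov (transition_row_sum hnonneg hdeg) m p t x j
        rw [hxj, mul_zero] at h0
        have h1 := measure_eq_zero_iff_ae_notMem.1 ((measureReal_eq_zero_iff).1 h0)
        filter_upwards [h1] with ω hω _ using hω
      · exact Eventually.of_forall fun ω h0 => absurd h0 hxj
    filter_upwards [hx] with ω hω h0
    exact hω (prefixes X (t + 1) ω) _ h0 ⟨rfl, rfl⟩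
  filter_upwards [hstart, hstep] with ω h0 h1 t
  induction t with
  | zero => rw [h0]
  | succ t ih =>
    rw [← ih]
    by_contra hne
    exact h1 t (transition_of_comp_ne (Ne.symm hne))

/-- The number of times `s < ℓ` at which the walk `(m, p)` is in `i`, and in `j` after `v` further
steps. -/
noncomputable def pairVisits (X : V → Fin r → ℕ → Ω → V) (m : V) (p : Fin r) (v : ℕ) (i j : V)
    (ℓ : ℕ) (ω : Ω) : ℝ :=
  ∑ s ∈ Finset.range ℓ, if X m p s ω = i ∧ X m p (s + v) ω = j then 1 else 0

lemma IsRun.tendsto_visits (h : IsRun μ (transition A) r w k X Z) (hsymm : A.IsSymm)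
    (hnonneg : ∀ i j, 0 ≤ A i j) (hdeg : ∀ i, 0 < ∑ j, A i j) (m : V) (p : Fin r) :
    ∀ᵐ ω ∂μ, ∀ i, Tendsto (fun ℓ : ℕ => (∑ t ∈ Finset.range ℓ,
      if X m p t ω = i then (1 : ℝ) else 0) / ℓ) atTop (𝓝 (visitFreq A m i)) := by
  have hmove : ∀ᵐ ω ∂μ, ∀ j, Tendsto (fun ℓ : ℕ => (∑ t ∈ Finset.range ℓ,
      increment (transition A) X m p j t ω) / ℓ) atTop (𝓝 0) := by
    refine ae_all_iff.2 fun j => ?_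
    have := h.tendsto_sum_increment (transition_nonneg hnonneg hdeg)
      (transition_row_sum hnonneg hdeg) m p j (g := fun _ _ => 1) (fun _ _ _ _ => rfl) (by simp)
    simpa only [one_mul] using this
  filter_upwards [h.ae_comp_eq hnonneg hdeg m p, hmove] with ω h1 h2 i
  exact tendsto_visits_div hsymm hnonneg hdeg (x := fun t => X m p t ω) h1 h2 i

/-- The frequency of visits to `i` followed by `j` after `v` steps. The induction on `v` needs only
one-step conditioning: a visit to `i` at time `t - v` is part of the history at time `t`. -/
lemma IsRun.tendsto_pairVisits (h : IsRun μ (transition A) r w k X Z) (hsymm : A.IsSymm)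
    (hnonneg : ∀ i j, 0 ≤ A i j) (hdeg : ∀ i, 0 < ∑ j, A i j) (m : V) (p : Fin r) (v : ℕ)
    (i j : V) :
    ∀ᵐ ω ∂μ, Tendsto (fun ℓ : ℕ => pairVisits X m p v i j ℓ ω / ℓ) atTop
      (𝓝 (visitFreq A m i * (transition A ^ v) i j)) := by
  induction v generalizing j with
  | zero =>
    filter_upwards [h.tendsto_visits hsymm hnonneg hdeg m p] with ω hω
    unfold pairVisits
    by_cases hij : i = j
    · subst hij
      simpa using hω i
    · have : ∀ t, ¬ (X m p t ω = i ∧ X m p (t + 0) ω = j) := fun t ht => hij (ht.1.symm.trans ht.2)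
      simp only [this, if_false, Finset.sum_const_zero, zero_div, pow_zero,
        Matrix.one_apply_ne hij, mul_zero]
      exact tendsto_const_nhds
  | succ v ih =>
    let g : ℕ → Ω → ℝ := fun t ω => if v ≤ t ∧ X m p (t - v) ω = i then 1 else 0
    have hg : ∀ t, Function.FactorsThrough (g t) (prefixes X (t + 1)) := by
      intro t ω ω' hω
      have : X m p (t - v) ω = X m p (t - v) ω' :=
        congrFun (congrFun (congrFun hω m) p) ⟨t - v, by omega⟩
      simp only [g, this]
    have hlim := h.tendsto_sum_increment (transition_nonneg hnonneg hdeg)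
      (transition_row_sum hnonneg hdeg) m p j hg
      (fun t ω => by simp only [g]; split_ifs <;> norm_num)
    have hih := ae_all_iff.2 ih
    filter_upwards [hlim, hih] with ω h1 h2
    have h3 := h1.comp (tendsto_add_atTop_nat v)
    have h4 : Tendsto (fun ℓ : ℕ => (∑ l, pairVisits X m p v i l ℓ ω / ℓ * transition A l j)) atTop
        (𝓝 (∑ l, visitFreq A m i * (transition A ^ v) i l * transition A l j)) :=
      tendsto_finsetSum _ fun l _ => (h2 l).mul_const _
    have hsum : ∀ ℓ, ∑ t ∈ Finset.range (ℓ + v), g t ω * increment (transition A) X m p j t ω =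
        pairVisits X m p (v + 1) i j ℓ ω - ∑ l, pairVisits X m p v i l ℓ ω * transition A l j := by
      intro ℓ
      have e1 : ∑ l, pairVisits X m p v i l ℓ ω * transition A l j =
          ∑ s ∈ Finset.range ℓ, if X m p s ω = i then transition A (X m p (s + v) ω) j else 0 := by
        simp_rw [pairVisits, Finset.sum_mul]
        rw [Finset.sum_comm]
        refine Finset.sum_congr rfl fun s _ => ?_
        by_cases hs : X m p s ω = i <;> simp [hs]
      rw [e1, pairVisits, ← Finset.sum_sub_distrib, add_comm ℓ v, Finset.sum_range_add]
      have e2 : ∑ t ∈ Finset.range v, g t ω * increment (transition A) X m p j t ω = 0 := by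
        refine Finset.sum_eq_zero fun t ht => ?_
        have : ¬ (v ≤ t ∧ X m p (t - v) ω = i) := fun hvt =>
          absurd (Finset.mem_range.1 ht) (not_lt.2 hvt.1)
        simp only [g, if_neg this, zero_mul]
      rw [e2, zero_add]
      refine Finset.sum_congr rfl fun s _ => ?_
      rw [add_comm v s, ← add_assoc s v 1]
      by_cases hs : X m p s ω = i <;> simp [g, increment, hs]
    have h5 := tendsto_zero_of_shift_div v (f := fun ℓ => pairVisits X m p (v + 1) i j ℓ ω -
      ∑ l, pairVisits X m p v i l ℓ ω * transition A l j)
      (h3.congr fun ℓ => by simp only [Function.comp_apply, hsum])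
    have h6 := h5.add h4
    rw [zero_add] at h6
    simp_rw [mul_assoc] at h6
    rw [← Finset.mul_sum, ← Matrix.mul_apply, ← pow_succ] at h6
    refine h6.congr fun ℓ => ?_
    rw [sub_div, Finset.sum_div]
    simp_rw [div_mul_eq_mul_div]
    ring

end Visits

/-! ### Counting positive and negative pairs -/

section Counting

variable {V : Type*} [Fintype V] {A : Matrix V V ℝ} {Ω : Type*} {r w k : ℕ}
  {X : V → Fin r → ℕ → Ω → V}
  {Z : (ℓ : ℕ) → PairIdx V r w ℓ → Fin k → Ω → V}

/-- Pairs of positions in a window, summed by their distance `v`. -/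
lemma sum_window (ℓ w : ℕ) (G : ℕ → ℕ → ℝ) :
    ∑ s : Fin ℓ, ∑ s' : Fin ℓ, (if (s : ℕ) < s' ∧ (s' : ℕ) ≤ s + w then G s s' else 0) =
      ∑ v ∈ Finset.Icc 1 w, ∑ s ∈ Finset.range (ℓ - v), G s (s + v) := by
  have h1 : ∀ v, ∑ s ∈ Finset.range (ℓ - v), G s (s + v) =
      ∑ s ∈ Finset.range ℓ, if s + v < ℓ then G s (s + v) else 0 := by
    intro v
    rw [← Finset.sum_filter]
    refine Finset.sum_congr ?_ fun _ _ => rfl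
    ext s
    simp only [Finset.mem_range, Finset.mem_filter]
    omega
  simp_rw [h1]
  rw [Finset.sum_comm (s := Finset.Icc 1 w), ← Fin.sum_univ_eq_sum_range
    (fun s => ∑ v ∈ Finset.Icc 1 w, if s + v < ℓ then G s (s + v) else 0)]
  refine Finset.sum_congr rfl fun s _ => ?_
  rw [Fin.sum_univ_eq_sum_range (fun s' => if (s : ℕ) < s' ∧ s' ≤ s + w then G s s' else 0),
    ← Finset.sum_filter, ← Finset.sum_filter]
  refine Finset.sum_nbij' (fun s' => s' - s) (fun v => s + v) ?_ ?_ ?_ ?_ ?_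
  · intro s' hs'
    simp only [Finset.mem_range, Finset.mem_filter, Finset.mem_Icc] at hs' ⊢
    omega
  · intro v hv
    simp only [Finset.mem_range, Finset.mem_filter, Finset.mem_Icc] at hv ⊢
    omega
  · intro s' hs'
    simp only [Finset.mem_range, Finset.mem_filter] at hs'
    omega
  · intro v _
    omega
  · intro s' hs'
    simp only [Finset.mem_range, Finset.mem_filter] at hs'
    rw [Nat.add_sub_cancel' (by omega)]

lemma sum_pairIdx (ℓ : ℕ) (G : V → Fin r → ℕ → ℕ → ℝ) :
    ∑ a : PairIdx V r w ℓ, G a.1.1 a.1.2.1 a.1.2.2.1 a.1.2.2.2 =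
      ∑ m, ∑ p, ∑ v ∈ Finset.Icc 1 w, ∑ s ∈ Finset.range (ℓ - v), G m p s (s + v) := by
  simp_rw [← fun m p => sum_window ℓ w (G m p)]
  rw [← Finset.sum_subtype (Finset.univ.filter fun a : V × Fin r × Fin ℓ × Fin ℓ =>
    (a.2.2.1 : ℕ) < (a.2.2.2 : ℕ) ∧ (a.2.2.2 : ℕ) ≤ (a.2.2.1 : ℕ) + w) (by simp)
    (fun a => G a.1 a.2.1 a.2.2.1 a.2.2.2), Finset.sum_filter]
  simp_rw [Fintype.sum_prod_type]

lemma card_pairIdx_le (ℓ : ℕ) :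
    (Fintype.card (PairIdx V r w ℓ) : ℝ) ≤ Fintype.card V * r * w * ℓ := by
  have h := sum_pairIdx (V := V) (r := r) (w := w) ℓ fun _ _ _ _ => 1
  rw [Finset.sum_const, Finset.card_univ, nsmul_eq_mul, mul_one] at h
  rw [h]
  calc ∑ _m : V, ∑ _p : Fin r, ∑ v ∈ Finset.Icc 1 w, ∑ _s ∈ Finset.range (ℓ - v), (1 : ℝ)
      ≤ ∑ _m : V, ∑ _p : Fin r, ∑ _v ∈ Finset.Icc 1 w, (ℓ : ℝ) := by
        refine Finset.sum_le_sum fun m _ => Finset.sum_le_sum fun p _ =>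
          Finset.sum_le_sum fun v _ => ?_
        rw [Finset.sum_const, Finset.card_range, nsmul_eq_mul, mul_one]
        exact_mod_cast Nat.sub_le ℓ v
    _ = Fintype.card V * r * w * ℓ := by
        simp
        ring

lemma nPos_eq_sum (i j : V) (ℓ : ℕ) (ω : Ω) :
    (nPos w X i j ℓ ω : ℝ) = ∑ a : PairIdx V r w ℓ,
      if firstNode (prefixes X ℓ ω) a = i ∧ secondNode (prefixes X ℓ ω) a = j then 1 else 0 := by
  rw [nPos, posMultiset, Multiset.count_map, Finset.sum_boole]
  congr 2
  ext
  simp [eq_comm]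

lemma nPos_eq (i j : V) (ℓ : ℕ) (ω : Ω) :
    (nPos w X i j ℓ ω : ℝ) =
      ∑ m, ∑ p, ∑ v ∈ Finset.Icc 1 w, pairVisits X m p v i j (ℓ - v) ω := by
  rw [nPos_eq_sum]
  exact sum_pairIdx ℓ fun m p s s' => if X m p s ω = i ∧ X m p s' ω = j then 1 else 0

lemma sum_nPos (i : V) (ℓ : ℕ) (ω : Ω) :
    ∑ j, (nPos w X i j ℓ ω : ℝ) = ∑ a : PairIdx V r w ℓ,
      if firstNode (prefixes X ℓ ω) a = i then 1 else 0 := by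
  simp_rw [nPos_eq_sum]
  rw [Finset.sum_comm]
  refine Finset.sum_congr rfl fun a _ => ?_
  by_cases h : firstNode (prefixes X ℓ ω) a = i <;> simp [h]

lemma nNeg_eq_sum (i j : V) (ℓ : ℕ) (ω : Ω) :
    (nNeg X Z i j ℓ ω : ℝ) = ∑ a : PairIdx V r w ℓ, ∑ c,
      if firstNode (prefixes X ℓ ω) a = i ∧ Z ℓ a c ω = j then 1 else 0 := by
  rw [nNeg, negMultiset, Multiset.count_map, ← Fintype.sum_prod_type', Finset.sum_boole]
  congr 2
  ext
  simp [eq_comm]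

lemma unigram_nonneg {ℓ : ℕ} (x : Paths V r ℓ) (j : V) : 0 ≤ unigram x j := by
  unfold unigram
  positivity

lemma sum_unigram [Nonempty V] {ℓ : ℕ} (hr : r ≠ 0) (hℓ : ℓ ≠ 0) (x : Paths V r ℓ) :
    ∑ j, unigram x j = 1 := by
  unfold unigram
  simp_rw [← Finset.sum_div, ← Finset.sum_boole]
  rw [Finset.sum_comm]
  have hn : Fintype.card V ≠ 0 := Fintype.card_ne_zero
  simp only [Finset.sum_ite_eq, Finset.mem_univ, if_true, Finset.sum_const, nsmul_eq_mul, mul_one,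
    Finset.card_univ, Fintype.card_prod, Fintype.card_fin]
  push_cast
  rw [← mul_assoc]
  exact div_self (by positivity)

lemma unigram_prefixes (j : V) (ℓ : ℕ) (ω : Ω) :
    unigram (prefixes X ℓ ω) j = (∑ m, ∑ p, (∑ t ∈ Finset.range ℓ,
      if X m p t ω = j then (1 : ℝ) else 0) / ℓ) / (Fintype.card V * r) := by
  simp_rw [← Finset.sum_div]
  rw [unigram, div_div, mul_comm (ℓ : ℝ), ← Finset.sum_boole]
  simp_rw [Fintype.sum_prod_type]
  congr 1
  refine Finset.sum_congr rfl fun m _ => Finset.sum_congr rfl fun p _ => ?_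
  exact Fin.sum_univ_eq_sum_range (fun t => if X m p t ω = j then (1 : ℝ) else 0) ℓ

variable [MeasurableSpace Ω] {μ : Measure Ω}

lemma IsRun.tendsto_nPos [Nonempty V] [IsProbabilityMeasure μ]
    (h : IsRun μ (transition A) r w k X Z) (hsymm : A.IsSymm)
    (hnonneg : ∀ i j, 0 ≤ A i j) (hdeg : ∀ i, 0 < ∑ j, A i j) (i j : V) :
    ∀ᵐ ω ∂μ, Tendsto (fun ℓ : ℕ => (nPos w X i j ℓ ω : ℝ) / ℓ) atTop
      (𝓝 (r * Fintype.card V *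
        (stationary A i * ∑ v ∈ Finset.Icc 1 w, (transition A ^ v) i j))) := by
  have hall := ae_all_iff.2 fun m => ae_all_iff.2 fun p => ae_all_iff.2 fun v =>
    h.tendsto_pairVisits hsymm hnonneg hdeg m p v i j
  filter_upwards [hall] with ω hω
  have hlim := tendsto_finsetSum Finset.univ fun (m : V) _ =>
    tendsto_finsetSum Finset.univ fun (p : Fin r) _ =>
      tendsto_finsetSum (Finset.Icc 1 w) fun v _ => tendsto_shift_div v (hω m p v)
  have hval : ∑ m, ∑ _p : Fin r, ∑ v ∈ Finset.Icc 1 w,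
      visitFreq A m i * (transition A ^ v) i j =
      r * Fintype.card V * (stationary A i * ∑ v ∈ Finset.Icc 1 w, (transition A ^ v) i j) := by
    simp_rw [← Finset.mul_sum, Finset.sum_const, Finset.card_univ, Fintype.card_fin, nsmul_eq_mul,
      ← mul_assoc]
    rw [← Finset.sum_mul, ← Finset.sum_mul, sum_visitFreq]
    ring
  rw [hval] at hlim
  refine hlim.congr fun ℓ => ?_
  simp_rw [nPos_eq, Finset.sum_div]

lemma IsRun.tendsto_unigram [Nonempty V] [IsProbabilityMeasure μ] (hr : r ≠ 0)
    (h : IsRun μ (transition A) r w k X Z) (hsymm : A.IsSymm)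
    (hnonneg : ∀ i j, 0 ≤ A i j) (hdeg : ∀ i, 0 < ∑ j, A i j) (j : V) :
    ∀ᵐ ω ∂μ, Tendsto (fun ℓ : ℕ => unigram (prefixes X ℓ ω) j) atTop (𝓝 (stationary A j)) := by
  have hall := ae_all_iff.2 fun m => ae_all_iff.2 fun p => h.tendsto_visits hsymm hnonneg hdeg m p
  filter_upwards [hall] with ω hω
  have hlim := (tendsto_finsetSum Finset.univ fun (m : V) _ =>
    tendsto_finsetSum Finset.univ fun (p : Fin r) _ => hω m p j).div_const
      ((Fintype.card V : ℝ) * r)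
  have hn : (Fintype.card V : ℝ) ≠ 0 := by exact_mod_cast Fintype.card_ne_zero
  have hval : (∑ m, ∑ _p : Fin r, visitFreq A m j) / ((Fintype.card V : ℝ) * r) =
      stationary A j := by
    simp_rw [Finset.sum_const, Finset.card_univ, Fintype.card_fin, nsmul_eq_mul]
    rw [← Finset.mul_sum, sum_visitFreq]
    field_simp
  rw [hval] at hlim
  exact hlim.congr fun ℓ => (unigram_prefixes j ℓ ω).symm

/-- The contribution to `n_{ij}^-` of one node `v` drawn for the occurrence `a`, centred by its
conditional mean given the walks `x`. -/
noncomputable def negDeviation {ℓ : ℕ} (i j : V) (x : Paths V r ℓ) (a : PairIdx V r w ℓ) (v : V) :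
    ℝ :=
  (if firstNode x a = i then 1 else 0) * ((if v = j then 1 else 0) - unigram x j)

lemma IsRun.measurableSet_prefixes_neg {P : Matrix V V ℝ} (h : IsRun μ P r w k X Z) (ℓ : ℕ)
    (y : Paths V r ℓ × (PairIdx V r w ℓ → Fin k → V)) :
    MeasurableSet {ω | (prefixes X ℓ ω, fun a b => Z ℓ a b ω) = y} := by
  have : {ω | (prefixes X ℓ ω, fun a b => Z ℓ a b ω) = y} =
      {ω | prefixes X ℓ ω = y.1} ∩ ⋂ a, ⋂ b, {ω | Z ℓ a b ω = y.2 a b} := by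
    ext ω
    simp [Prod.ext_iff, funext_iff]
  rw [this]
  exact (h.measurableSet_prefixes ℓ y.1).inter <| MeasurableSet.iInter fun a =>
    MeasurableSet.iInter fun b =>
      h.measurable_neg ℓ a b (show MeasurableSet[⊤] ({y.2 a b} : Set V) from trivial)

/-- Given the walks, the deviations are independent, centred and bounded by `1`. -/
lemma IsRun.mgf_negDeviation_le [Nonempty V] [IsProbabilityMeasure μ] {P : Matrix V V ℝ}
    (hr : r ≠ 0) (h : IsRun μ P r w k X Z) (i j : V) (ℓ : ℕ) {c : ℝ} (hc : |c| ≤ 1) :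
    ∫ ω, Real.exp (c * ∑ a, ∑ b, negDeviation i j (prefixes X ℓ ω) a (Z ℓ a b ω)) ∂μ ≤
      Real.exp (Fintype.card (PairIdx V r w ℓ) * k * c ^ 2) := by
  have hmeas := h.measurableSet_prefixes_neg ℓ
  have hone : ∑ x : Paths V r ℓ, μ.real {ω | prefixes X ℓ ω = x} = 1 := by
    have := integral_comp_eq_sum (μ := μ) (h.measurableSet_prefixes ℓ) fun _ => 1
    simpa using this.symm
  have hfactor : ∀ (x : Paths V r ℓ) (a : PairIdx V r w ℓ),
      ∑ v, unigram x v * Real.exp (c * negDeviation i j x a v) ≤ Real.exp (c ^ 2) := by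
    intro x a
    -- an occurrence exists only for positive walk lengths
    have hℓ : ℓ ≠ 0 := by
      rintro rfl
      exact a.1.2.2.1.elim0
    have hsum := sum_unigram hr hℓ x
    have hle : unigram x j ≤ 1 :=
      hsum ▸ Finset.single_le_sum (fun v _ => unigram_nonneg x v) (Finset.mem_univ j)
    have hdev : ∀ v, |negDeviation i j x a v| ≤ 1 := by
      intro v
      have h0 := unigram_nonneg x j
      unfold negDeviation
      rw [abs_le]
      split_ifs <;> constructor <;> linarith
    have hmean : ∑ v, unigram x v * negDeviation i j x a v = 0 := by
      unfold negDeviation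
      simp_rw [mul_left_comm (unigram x _)]
      rw [← Finset.mul_sum]
      simp [mul_sub, ← Finset.sum_mul, hsum]
    calc ∑ v, unigram x v * Real.exp (c * negDeviation i j x a v)
        ≤ ∑ v, unigram x v * (1 + c * negDeviation i j x a v + c ^ 2) :=
          Finset.sum_le_sum fun v _ =>
            mul_le_mul_of_nonneg_left (exp_mul_le hc (hdev v)) (unigram_nonneg x v)
      _ = (1 + c ^ 2) * ∑ v, unigram x v + c * ∑ v, unigram x v * negDeviation i j x a v := by
          rw [Finset.mul_sum, Finset.mul_sum, ← Finset.sum_add_distrib]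
          exact Finset.sum_congr rfl fun v _ => by ring
      _ ≤ Real.exp (c ^ 2) := by
          rw [hsum, hmean]
          linarith [Real.add_one_le_exp (c ^ 2)]
  have hprob : ∀ (x : Paths V r ℓ) (z : PairIdx V r w ℓ → Fin k → V),
      μ.real {ω | (prefixes X ℓ ω, fun a b => Z ℓ a b ω) = (x, z)} =
        μ.real {ω | prefixes X ℓ ω = x} * ∏ a, ∏ b, unigram x (z a b) := by
    intro x z
    rw [← h.neg_law]
    simp only [Prod.mk.injEq, funext_iff]
  calc ∫ ω, Real.exp (c * ∑ a, ∑ b, negDeviation i j (prefixes X ℓ ω) a (Z ℓ a b ω)) ∂μ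
      = ∑ x : Paths V r ℓ, ∑ z : PairIdx V r w ℓ → Fin k → V,
          μ.real {ω | (prefixes X ℓ ω, fun a b => Z ℓ a b ω) = (x, z)} *
            Real.exp (c * ∑ a, ∑ b, negDeviation i j x a (z a b)) := by
        rw [← Fintype.sum_prod_type']
        exact integral_comp_eq_sum hmeas fun y =>
          Real.exp (c * ∑ a, ∑ b, negDeviation i j y.1 a (y.2 a b))
    _ = ∑ x : Paths V r ℓ, μ.real {ω | prefixes X ℓ ω = x} *
          ∏ a, ∏ _b : Fin k, ∑ v, unigram x v * Real.exp (c * negDeviation i j x a v) := by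
        refine Finset.sum_congr rfl fun x _ => ?_
        rw [prod_prod_sum, Finset.mul_sum]
        refine Finset.sum_congr rfl fun z _ => ?_
        rw [hprob, mul_assoc]
        simp_rw [Finset.mul_sum, Real.exp_sum, Finset.prod_mul_distrib]
    _ ≤ ∑ x : Paths V r ℓ, μ.real {ω | prefixes X ℓ ω = x} *
          ∏ _a : PairIdx V r w ℓ, ∏ _b : Fin k, Real.exp (c ^ 2) := by
        refine Finset.sum_le_sum fun x _ =>
          mul_le_mul_of_nonneg_left ?_ measureReal_nonneg
        have h0 : ∀ a : PairIdx V r w ℓ,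
            0 ≤ ∑ v, unigram x v * Real.exp (c * negDeviation i j x a v) := fun a =>
          Finset.sum_nonneg fun v _ => mul_nonneg (unigram_nonneg x v) (Real.exp_pos _).le
        exact Finset.prod_le_prod (fun a _ => Finset.prod_nonneg fun b _ => h0 a) fun a _ =>
          Finset.prod_le_prod (fun b _ => h0 a) fun b _ => hfactor x a
    _ = Real.exp (Fintype.card (PairIdx V r w ℓ) * k * c ^ 2) := by
        rw [← Finset.sum_mul, hone, one_mul]
        simp_rw [Finset.prod_const, Finset.card_univ, Fintype.card_fin]
        rw [← Real.exp_nat_mul, ← Real.exp_nat_mul, mul_assoc]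

lemma IsRun.tendsto_negDeviation [Nonempty V] [IsProbabilityMeasure μ] {P : Matrix V V ℝ}
    (hr : r ≠ 0) (h : IsRun μ P r w k X Z) (i j : V) :
    ∀ᵐ ω ∂μ, Tendsto (fun ℓ : ℕ =>
      (∑ a, ∑ b, negDeviation i j (prefixes X ℓ ω) a (Z ℓ a b ω)) / ℓ) atTop (𝓝 0) := by
  -- the `+ 1` makes the constant positive also if `w` or `k` is `0`
  refine tendsto_div_zero_of_mgf_le (C := Fintype.card V * r * w * k + 1) (by positivity)
    (fun ℓ c => ?_) fun ℓ c hc => ?_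
  · exact integrable_comp_of_finite (h.measurableSet_prefixes_neg ℓ) fun y =>
      Real.exp (c * ∑ a, ∑ b, negDeviation i j y.1 a (y.2 a b))
  · refine (h.mgf_negDeviation_le hr i j ℓ hc).trans (Real.exp_le_exp.2 ?_)
    refine mul_le_mul_of_nonneg_right ?_ (sq_nonneg c)
    have h1 := mul_le_mul_of_nonneg_right (card_pairIdx_le (V := V) (r := r) (w := w) ℓ)
      (Nat.cast_nonneg (α := ℝ) k)
    have h2 : (0 : ℝ) ≤ ℓ := Nat.cast_nonneg ℓ
    linarith

lemma IsRun.tendsto_nNeg [Nonempty V] [IsProbabilityMeasure μ] (hr : r ≠ 0)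
    (h : IsRun μ (transition A) r w k X Z) (hsymm : A.IsSymm)
    (hnonneg : ∀ i j, 0 ≤ A i j) (hdeg : ∀ i, 0 < ∑ j, A i j) (i j : V) :
    ∀ᵐ ω ∂μ, Tendsto (fun ℓ : ℕ => (nNeg X Z i j ℓ ω : ℝ) / ℓ) atTop
      (𝓝 (r * Fintype.card V * (k * w * stationary A i * stationary A j))) := by
  filter_upwards [h.tendsto_negDeviation hr i j, h.tendsto_unigram hr hsymm hnonneg hdeg j,
    ae_all_iff.2 fun j' => h.tendsto_nPos hsymm hnonneg hdeg i j'] with ω h1 h2 h3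
  have h4 := h1.add (((tendsto_finsetSum Finset.univ fun j' _ => h3 j').const_mul (k : ℝ)).mul h2)
  have hval : 0 + (k : ℝ) * (∑ j', r * Fintype.card V *
      (stationary A i * ∑ v ∈ Finset.Icc 1 w, (transition A ^ v) i j')) * stationary A j =
      r * Fintype.card V * (k * w * stationary A i * stationary A j) := by
    rw [← Finset.mul_sum, ← Finset.mul_sum, Finset.sum_comm]
    simp_rw [transition_pow_row_sum hnonneg hdeg]
    simp
    ring
  rw [hval] at h4
  refine h4.congr fun ℓ => ?_
  rw [← Finset.sum_div, sum_nPos, nNeg_eq_sum, mul_div_assoc', div_mul_eq_mul_div, ← add_div]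
  congr 1
  rw [Finset.mul_sum, Finset.sum_mul, ← Finset.sum_add_distrib]
  refine Finset.sum_congr rfl fun a _ => ?_
  by_cases ha : firstNode (prefixes X ℓ ω) a = i <;> simp [negDeviation, ha]

end Counting

end VEC

theorem theorem1 {V : Type*} [Fintype V] [Nonempty V]
    (A : Matrix V V ℝ) (hsymm : A.IsSymm) (hnonneg : ∀ i j, 0 ≤ A i j)
    (hdeg : ∀ i, 0 < ∑ j, A i j)
    (r w k : ℕ) (hr : 1 ≤ r)
    {Ω : Type*} [MeasurableSpace Ω] (μ : Measure Ω) [IsProbabilityMeasure μ]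
    (X : V → Fin r → ℕ → Ω → V) (Z : (ℓ : ℕ) → VEC.PairIdx V r w ℓ → Fin k → Ω → V)
    (hrun : VEC.IsRun μ (VEC.transition A) r w k X Z) :
    VEC.IsStationaryDistribution (VEC.transition A) (VEC.stationary A) ∧
    (∀ (t : VEC.Component A) (i j : t.supp),
      VEC.HasErgodicLimit μ r (Fintype.card V) (VEC.nPos w X i j)
        (VEC.stationary A i * ∑ v ∈ Finset.Icc 1 w, (VEC.compW A t ^ v) i j)) ∧
    (∀ i j : V, VEC.comp A i ≠ VEC.comp A j →
      VEC.HasErgodicLimit μ r (Fintype.card V) (VEC.nPos w X i j) 0) ∧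
    (∀ i j : V, VEC.HasErgodicLimit μ r (Fintype.card V) (VEC.nNeg X Z i j)
      ((k : ℝ) * (w : ℝ) * VEC.stationary A i * VEC.stationary A j)) := by
  have hr0 : r ≠ 0 := by omega
  have hn : (r : ℝ) * Fintype.card V ≠ 0 :=
    mul_ne_zero (by exact_mod_cast hr0) (by exact_mod_cast Fintype.card_ne_zero)
  have hscale : ∀ a : ℝ, a = 1 / ((r : ℝ) * Fintype.card V) * (r * Fintype.card V * a) :=
    fun a => by rw [one_div, inv_mul_cancel_left₀ hn]
  refine ⟨VEC.isStationaryDistribution hsymm hnonneg hdeg, fun t i j => ?_, fun i j hij => ?_,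
    fun i j => ?_⟩
  · refine ⟨_, hrun.tendsto_nPos hsymm hnonneg hdeg i j, ?_⟩
    simp_rw [VEC.transition_pow_apply hnonneg hdeg]
    exact hscale _
  · refine ⟨_, hrun.tendsto_nPos hsymm hnonneg hdeg i j, ?_⟩
    simp_rw [VEC.transition_pow_of_comp_ne _ hij]
    simp
  · exact ⟨_, hrun.tendsto_nNeg hr0 hsymm hnonneg hdeg i j, hscale _⟩
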